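/- **Setting.** Let $M$ be a smooth compact Riemannian manifold without boundary, with distance $\rho$ (taken to be $\infty$ between different components), let $f:M\to M$ be a $C^1$ diffeomorphism, and let $|\cdot|$ be the norm on $TM$ given by the Riemannian metric. For a linear map $T$ between normed spaces let $\|T\|$ be its operator norm and $m(T)=\inf_{v\neq 0}|Tv|/|v|$ its minimum norm ($m(T)=\infty$ if the domain of $T$ is $\{0\}$). A splitting $G=G^u\oplus G^s$ assigns to points $y\in M$ a decomposition $T_yM=G^u_y\oplus G^s_y$ into linear subspaces. With respect to it, write $$D_yf=\begin{pmatrix}A_y&B_y\\ C_y&D_y\end{pmatrix}:\ G^u_y\oplus G^s_y\to G^u_{f(y)}\oplus G^s_{f(y)} .$$ For $\lambda\in(0,1)$, $\varepsilon\ge 0$, $x\in M$ and an integer $n\ge 1$, the orbit segment $\{x,n\}=\{x,fx,\dots,f^nx\}$ is *$(\lambda,\varepsilon)$-quasi-semi-hyperbolic with respect to $G$* if, with $A_j=A_{f^jx}$, and similarly $B_j,C_j,D_j$, $$\prod_{j=0}^{k-1}\|D_j\|\le\lambda^k\ (1\le k\le n),\qquad \prod_{j=k}^{n-1}m(A_j)\ge\lambda^{k-n}\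 (0\le k\le n-1),$$ $$\frac{\|D_j\|}{m(A_j)}\le\lambda^2,\qquad \|B_j\|\le\varepsilon,\quad \|C_j\|\le\varepsilon\qquad(0\le j\le n-1).$$ Let $(x_i)_{i\in\mathbb Z}$ be points of $M$ and $(n_i)_{i\in\mathbb Z}$ positive integers. The sequence $\{x_i,n_i\}_{i\in\mathbb Z}$ is a *$(\lambda,\varepsilon,\delta)$-quasi-semi-hyperbolic pseudo-orbit with respect to $G$* if, for every $i\in\mathbb Z$, the segment $\{x_i,n_i\}$ is $(\lambda,\varepsilon)$-quasi-semi-hyperbolic with respect to $G$ and $\rho(f^{n_i}x_i,x_{i+1})\le\delta$. It is a *$(\lambda,\delta)$-quasi-hyperbolic pseudo-orbit with respect to $G$* if this holds with $\varepsilon=0$, so that $B_j=C_j=0$, i.e. $G$ is $Df$-invariant along each of the segments. **Theorem 2.1.** Let $0<\lambda<\tilde\lambda<1$ and let $TM=E^u\oplus E^s$ be a continuous splitting. Then there exist $\varepsilon_0>0$ and $\delta_0>0$ such that for all $0<\varepsilon\le\varepsilon_0$ and $0<\delta\le\delta_0$, every $(\lambda,\varepsilon,\delta)$-quasi-semi-hyperbolic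 pseudo-orbit $\{x_i,n_i\}_{i\in\mathbb Z}$ with respect to $E^u\oplus E^s$ is a $(\tilde\lambda,\delta)$-quasi-hyperbolic pseudo-orbit with respect to some splitting $G^u\oplus G^s$ of the tangent spaces at its points. -/

import Mathlib

open scoped Manifold ContDiff ENNReal
open Bundle

noncomputable section

namespace QuasiHyp

instance instFiniteDimensionalTangent {E : Type*} [NormedAddCommGroup E] [NormedSpace ℝ E] [FiniteDimensional ℝ E]
  {M : Type*} [TopologicalSpace M]
    [ChartedSpace E M] (x : M) :
    FiniteDimensional ℝ (TangentSpace 𝓘(ℝ, E) x) :=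
  inferInstanceAs (FiniteDimensional ℝ E)

/-- The operator norm of a linear map on a finite-dimensional normed space. -/
def opNorm {V W : Type*} [NormedAddCommGroup V] [NormedSpace ℝ V] [FiniteDimensional ℝ V]
    [NormedAddCommGroup W] [NormedSpace ℝ W] (T : V →ₗ[ℝ] W) : ℝ :=
  ‖LinearMap.toContinuousLinearMap T‖

/-- The minimum norm `m(T) = inf {|T v| / |v| : v ≠ 0}` of a linear map. It takes values in
`[0, ∞]`, so that it is `∞` (an infimum over the empty set) on the zero space. -/
def minNorm {V W : Type*} [NormedAddCommGroup V] [NormedSpace ℝ V]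
    [NormedAddCommGroup W] [NormedSpace ℝ W] (T : V →ₗ[ℝ] W) : ℝ≥0∞ :=
  ⨅ (v : V) (_ : v ≠ 0), ‖T v‖ₑ / ‖v‖ₑ

/-- A splitting `T_x M = E^u_x ⊕ E^s_x` of every tangent space of `M`, with no regularity in `x`
and no invariance. -/
structure TangentSplitting (E : Type*) [NormedAddCommGroup E] [NormedSpace ℝ E] (M : Type*) [TopologicalSpace M]
    [ChartedSpace E M] where
  /-- the summand `E^u_x` -/
  u : ∀ x : M, Submodule ℝ (TangentSpace 𝓘(ℝ, E) x)
  /-- the summand `E^s_x` -/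
  s : ∀ x : M, Submodule ℝ (TangentSpace 𝓘(ℝ, E) x)
  isCompl : ∀ x : M, IsCompl (u x) (s x)

section Blocks

variable {E : Type*} [NormedAddCommGroup E] [NormedSpace ℝ E] [FiniteDimensional ℝ E]
  {M : Type*} [TopologicalSpace M] [ChartedSpace E M]

/-- The projection `T_x M → E^u_x` along `E^s_x`. -/
def TangentSplitting.projU (G : TangentSplitting E M) (x : M) :
    TangentSpace 𝓘(ℝ, E) x →ₗ[ℝ] G.u x :=
  (G.u x).projectionOnto (G.s x) (G.isCompl x)

/-- The projection `T_x M → E^s_x` along `E^u_x`. -/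
def TangentSplitting.projS (G : TangentSplitting E M) (x : M) :
    TangentSpace 𝓘(ℝ, E) x →ₗ[ℝ] G.s x :=
  (G.s x).projectionOnto (G.u x) (G.isCompl x).symm

/-- A splitting `TM = E^u ⊕ E^s` is continuous if the two bundle maps `TM → TM` that project onto
its summands are continuous. -/
def TangentSplitting.IsContinuous [IsManifold 𝓘(ℝ, E) 1 M] (G : TangentSplitting E M) : Prop :=
  Continuous (fun p : TangentBundle 𝓘(ℝ, E) M =>
      (⟨p.1, (G.projU p.1 p.2 : TangentSpace 𝓘(ℝ, E) p.1)⟩ : TangentBundle 𝓘(ℝ, E) M)) ∧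
    Continuous (fun p : TangentBundle 𝓘(ℝ, E) M =>
      (⟨p.1, (G.projS p.1 p.2 : TangentSpace 𝓘(ℝ, E) p.1)⟩ : TangentBundle 𝓘(ℝ, E) M))

variable [RiemannianBundle (fun x : M => TangentSpace 𝓘(ℝ, E) x)]

/-! The four blocks of `D_x f : T_x M → T_{f x} M`, written as a matrix with rows `A B` and `C D`
with respect to `T_x M = E^u_x ⊕ E^s_x` and `T_{f x} M = E^u_{f x} ⊕ E^s_{f x}`. The summands
carry the norm of the Riemannian metric. -/

/-- The block `E^u_x → E^u_{f x}` of the derivative of `f` at `x`. -/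
def blockA (f : M → M) (G : TangentSplitting E M) (x : M) : G.u x →ₗ[ℝ] G.u (f x) :=
  G.projU (f x) ∘ₗ (mfderiv 𝓘(ℝ, E) 𝓘(ℝ, E) f x).toLinearMap ∘ₗ (G.u x).subtype

/-- The block `E^s_x → E^u_{f x}` of the derivative of `f` at `x`. -/
def blockB (f : M → M) (G : TangentSplitting E M) (x : M) : G.s x →ₗ[ℝ] G.u (f x) :=
  G.projU (f x) ∘ₗ (mfderiv 𝓘(ℝ, E) 𝓘(ℝ, E) f x).toLinearMap ∘ₗ (G.s x).subtype

/-- The block `E^u_x → E^s_{f x}` of the derivative of `f` at `x`. -/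
def blockC (f : M → M) (G : TangentSplitting E M) (x : M) : G.u x →ₗ[ℝ] G.s (f x) :=
  G.projS (f x) ∘ₗ (mfderiv 𝓘(ℝ, E) 𝓘(ℝ, E) f x).toLinearMap ∘ₗ (G.u x).subtype

/-- The block `E^s_x → E^s_{f x}` of the derivative of `f` at `x`. -/
def blockD (f : M → M) (G : TangentSplitting E M) (x : M) : G.s x →ₗ[ℝ] G.s (f x) :=
  G.projS (f x) ∘ₗ (mfderiv 𝓘(ℝ, E) 𝓘(ℝ, E) f x).toLinearMap ∘ₗ (G.s x).subtype

/-- The orbit segment `{x, n} = {x, f x, …, f^n x}` is `(lam, ε)`-quasi-semi-hyperbolic with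
respect to the splitting `G`. Only the values of `G` at the points `f^j x`, `0 ≤ j ≤ n`, matter. -/
structure IsQuasiSemiHyperbolicArc (f : M → M) (G : TangentSplitting E M) (lam ε : ℝ)
    (x : M) (n : ℕ) : Prop where
  prod_D : ∀ k : ℕ, 1 ≤ k → k ≤ n →
    ∏ j ∈ Finset.range k, opNorm (blockD f G (f^[j] x)) ≤ lam ^ k
  prod_A : ∀ k : ℕ, k < n →
    ENNReal.ofReal (lam ^ ((k : ℤ) - (n : ℤ))) ≤
      ∏ j ∈ Finset.Ico k n, minNorm (blockA f G (f^[j] x))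
  ratio : ∀ j : ℕ, j < n →
    ENNReal.ofReal (opNorm (blockD f G (f^[j] x))) / minNorm (blockA f G (f^[j] x)) ≤ ENNReal.ofReal (lam ^ 2)
  norm_B : ∀ j : ℕ, j < n → opNorm (blockB f G (f^[j] x)) ≤ ε
  norm_C : ∀ j : ℕ, j < n → opNorm (blockC f G (f^[j] x)) ≤ ε

end Blocks

section PseudoOrbits

variable {E : Type*} [NormedAddCommGroup E] [NormedSpace ℝ E] [FiniteDimensional ℝ E]
  {M : Type*} [EMetricSpace M] [ChartedSpace E M]
  [RiemannianBundle (fun x : M => TangentSpace 𝓘(ℝ, E) x)]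

/-- The two-sided sequence of orbit segments `{x_i, n_i}`, `n_i ≥ 1`, is a
`(lam, ε, δ)`-quasi-semi-hyperbolic pseudo-orbit with respect to the splitting `G`. -/
structure IsQuasiSemiHyperbolicPseudoOrbit (f : M → M) (G : TangentSplitting E M)
    (lam ε δ : ℝ) (x : ℤ → M) (n : ℤ → ℕ) : Prop where
  length_pos : ∀ i, 0 < n i
  arc : ∀ i, IsQuasiSemiHyperbolicArc f G lam ε (x i) (n i)
  jump : ∀ i, edist (f^[n i] (x i)) (x (i + 1)) ≤ ENNReal.ofReal δ

/-- `{x_i, n_i}` is a `(lam, δ)`-quasi-hyperbolic pseudo-orbit with respect to the splitting `G`: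
the case `ε = 0`, in which the blocks `B`, `C` vanish along the segments, that is, `G` is
`Df`-invariant along them. -/
def IsQuasiHyperbolicPseudoOrbit (f : M → M) (G : TangentSplitting E M)
    (lam δ : ℝ) (x : ℤ → M) (n : ℤ → ℕ) : Prop :=
  IsQuasiSemiHyperbolicPseudoOrbit f G lam 0 δ x n

end PseudoOrbits

end QuasiHyp

end

/-!
Invariance of a splitting is a condition on the single steps `y ↦ f y` of the segments, and the
gap `‖D_y‖ ≤ λ² m(A_y)` is available at every such step. Hence neither the products along the
segments nor the jumps between them matter for the construction of `G`; in particular segments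
that overlap, continue each other or close up to a periodic orbit need no separate treatment.

Since `f` is a `C¹` diffeomorphism and `M` is compact, `‖Df v‖ ≥ c ‖v‖` for some `c > 0`
(`exists_le_norm_mfderiv`). If `ε` is small compared with `c`, then `A_y` and `D_y` are bounded
below by `c - ε` at each step `y`, so that they are injective and, by a dimension count,
invertible; `B_y` and `C_y` are small compared with the gap between `m(A_y)` and `‖D_y‖`
(`isDominated_of_ratio`). The graph transform of `Df` then contracts. Forward in time it acts on
maps `P_y : E^u_y → E^s_y` of norm at most `η`, backward in time on maps `Q_y : E^s_y → E^u_y`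
of norm at most `η`. Sections over all of `M` that are bounded by `η`, without any continuity in
`y`, form a complete space, so both transforms have fixed points
(`exists_invariant_graph_forward`, `exists_invariant_graph_backward`).

The graphs of `P_y` and `Q_y` are the summands of `G`. Because `‖P‖, ‖Q‖ ≤ η` and `ε` is small
compared with `m(A)` and `m(D)`, passing from `E^u ⊕ E^s` to `G` costs at most the factor
`λ / λ̃` in `m(A)` and its inverse in `‖D‖` at every step (`isComparableAt_graphs`), and this
turns all the estimates with rate `λ` into estimates with rate `λ̃`
(`IsQuasiSemiHyperbolicArc.of_isComparableAt`).
-/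

namespace QuasiHyp

/-! ### Fixed points of contractions on bounded sections -/

section FixedSection

/-- Banach's fixed point theorem for sections of a family of complete normed groups, bounded by
`η` in the supremum norm. The contraction hypothesis concerns uniform bounds only, so `T` may
move the fibres around. -/
theorem exists_fixed_section {ι : Type*} {V : ι → Type*} [∀ i, NormedAddCommGroup (V i)]
    [∀ i, CompleteSpace (V i)] (T : (∀ i, V i) → ∀ i, V i) {η κ : ℝ} (hη : 0 ≤ η) (hκ : 0 ≤ κ)
    (hκ1 : κ < 1) (maps : ∀ P, (∀ i, ‖P i‖ ≤ η) → ∀ i, ‖T P i‖ ≤ η)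
    (lip : ∀ P P', (∀ i, ‖P i‖ ≤ η) → (∀ i, ‖P' i‖ ≤ η) → ∀ r, 0 ≤ r →
      (∀ i, ‖P i - P' i‖ ≤ r) → ∀ i, ‖T P i - T P' i‖ ≤ κ * r) :
    ∃ P, (∀ i, ‖P i‖ ≤ η) ∧ T P = P := by
  let u : ℕ → ∀ i, V i := fun n => T^[n] 0
  have u_succ (n : ℕ) : u (n + 1) = T (u n) := Function.iterate_succ_apply' T n 0
  have u_le (n : ℕ) : ∀ i, ‖u n i‖ ≤ η := by
    induction n with
    | zero => intro i; simpa [u] using hη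
    | succ n ih => rw [u_succ]; exact maps _ ih
  have step (n : ℕ) : ∀ i, ‖u n i - u (n + 1) i‖ ≤ η * κ ^ n := by
    induction n with
    | zero => intro i; simpa [u] using maps 0 (fun _ => by simpa using hη) i
    | succ n ih =>
      intro i
      have h := lip _ _ (u_le n) (u_le (n + 1)) _ (by positivity) ih i
      rw [u_succ n, u_succ (n + 1)]
      calc _ ≤ _ := h
        _ = _ := by ring
  have step' (i : ι) (n : ℕ) : dist (u n i) (u (n + 1) i) ≤ η * κ ^ n := by
    rw [dist_eq_norm]; exact step n i
  choose P hP using fun i => cauchySeq_tendsto_of_complete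
    (cauchySeq_of_le_geometric κ η hκ1 (step' i))
  have P_le (i : ι) : ‖P i‖ ≤ η :=
    le_of_tendsto (hP i).norm (Filter.Eventually.of_forall fun n => u_le n i)
  have u_sub (n : ℕ) (i : ι) : ‖u n i - P i‖ ≤ η * κ ^ n / (1 - κ) := by
    rw [← dist_eq_norm]
    exact dist_le_of_le_geometric_of_tendsto κ η hκ1 (step' i) (hP i) n
  refine ⟨P, P_le, funext fun i => ?_⟩
  have lim : Filter.Tendsto (fun n => u (n + 1) i) Filter.atTop (nhds (T P i)) := by
    rw [tendsto_iff_norm_sub_tendsto_zero]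
    have h0 : Filter.Tendsto (fun n : ℕ => κ * (η * κ ^ n / (1 - κ))) Filter.atTop (nhds 0) := by
      simpa using (((tendsto_pow_atTop_nhds_zero_of_lt_one hκ hκ1).const_mul η).div_const
        (1 - κ)).const_mul κ
    refine squeeze_zero (fun n => norm_nonneg _) (fun n => ?_) h0
    rw [u_succ]
    have : 0 < 1 - κ := by linarith
    exact lip _ _ (u_le n) P_le _ (by positivity) (u_sub n) i
  exact tendsto_nhds_unique lim ((Filter.tendsto_add_atTop_iff_nat 1).2 (hP i))

end FixedSection

/-! ### The graph transform of a dominated block matrix -/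

section GraphTransform

variable {U S U' S' : Type*}
  [NormedAddCommGroup U] [NormedSpace ℝ U] [NormedAddCommGroup S] [NormedSpace ℝ S]
  [NormedAddCommGroup U'] [NormedSpace ℝ U'] [NormedAddCommGroup S'] [NormedSpace ℝ S']

/-- The block matrix with rows `A B` and `C D`, from `U ⊕ S` to `U' ⊕ S'`, is dominated with
constants `σ` and `τ`: some number `a > 0` bounds the expansion of `A` from below, and the norm
of `D` is at most `σ a` and those of `B` and `C` at most `τ a`. Moreover `U` and `U'` have the
same dimension, so that `A` is invertible. -/
structure IsDominated (A : U →ₗ[ℝ] U') (B : S →ₗ[ℝ] U') (C : U →ₗ[ℝ] S') (D : S →ₗ[ℝ] S')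
    (σ τ : ℝ) : Prop where
  finrank_eq : Module.finrank ℝ U = Module.finrank ℝ U'
  exists_scale : ∃ a : ℝ, 0 < a ∧ (∀ u, a * ‖u‖ ≤ ‖A u‖) ∧ (∀ s, ‖B s‖ ≤ τ * a * ‖s‖) ∧
    (∀ u, ‖C u‖ ≤ τ * a * ‖u‖) ∧ ∀ s, ‖D s‖ ≤ σ * a * ‖s‖

theorem injective_of_bound {L : U →ₗ[ℝ] U'} {b : ℝ} (hb : 0 < b) (hL : ∀ u, b * ‖u‖ ≤ ‖L u‖) :
    Function.Injective L := by
  rw [injective_iff_map_eq_zero]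
  intro u hu
  have h := hL u
  rw [hu, norm_zero] at h
  exact norm_le_zero_iff.1 (nonpos_of_mul_nonpos_right h hb)

/-- An expanding map between spaces of equal dimension is invertible. -/
theorem exists_linearEquiv_of_bound [FiniteDimensional ℝ U] [FiniteDimensional ℝ U']
    (hdim : Module.finrank ℝ U = Module.finrank ℝ U')
    {L : U →ₗ[ℝ] U'} {b : ℝ} (hb : 0 < b) (hL : ∀ u, b * ‖u‖ ≤ ‖L u‖) :
    ∃ e : U ≃ₗ[ℝ] U', ∀ u, e u = L u :=
  have hinj := injective_of_bound hb hL
  ⟨LinearEquiv.ofBijective L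
    ⟨hinj, (LinearMap.injective_iff_surjective_of_finrank_eq_finrank hdim).1 hinj⟩, fun _ => rfl⟩

/-- The right quotient `N L⁻¹`, with its norm estimate. -/
theorem exists_comp_eq [FiniteDimensional ℝ U] [FiniteDimensional ℝ U']
    (hdim : Module.finrank ℝ U = Module.finrank ℝ U')
    {L : U →ₗ[ℝ] U'} {N : U →ₗ[ℝ] S'} {b η : ℝ} (hb : 0 < b) (hη : 0 ≤ η)
    (hL : ∀ u, b * ‖u‖ ≤ ‖L u‖) (hN : ∀ u, ‖N u‖ ≤ η * b * ‖u‖) :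
    ∃ P : U' →L[ℝ] S', ‖P‖ ≤ η ∧ ∀ u, P (L u) = N u := by
  obtain ⟨e, he⟩ := exists_linearEquiv_of_bound hdim hb hL
  refine ⟨LinearMap.toContinuousLinearMap (N ∘ₗ e.symm.toLinearMap), ?_, fun u => ?_⟩
  · refine ContinuousLinearMap.opNorm_le_bound _ hη fun v => ?_
    obtain ⟨u, rfl⟩ := e.surjective v
    have h := mul_le_mul_of_nonneg_left (hL u) hη
    have h' : ‖N u‖ ≤ η * ‖L u‖ := (hN u).trans (by linarith)
    rw [← he] at h'
    simpa using h'
  · simp [← he]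

/-- The left quotient `L⁻¹ N`, with its norm estimate. -/
theorem exists_eq_comp [FiniteDimensional ℝ U] [FiniteDimensional ℝ U'] [FiniteDimensional ℝ S]
    (hdim : Module.finrank ℝ U = Module.finrank ℝ U')
    {L : U →ₗ[ℝ] U'} {N : S →ₗ[ℝ] U'} {b η : ℝ} (hb : 0 < b) (hη : 0 ≤ η)
    (hL : ∀ u, b * ‖u‖ ≤ ‖L u‖) (hN : ∀ s, ‖N s‖ ≤ η * b * ‖s‖) :
    ∃ Q : S →L[ℝ] U, ‖Q‖ ≤ η ∧ ∀ s, L (Q s) = N s := by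
  obtain ⟨e, he⟩ := exists_linearEquiv_of_bound hdim hb hL
  have key (s : S) : L (e.symm (N s)) = N s := by rw [← he, e.apply_symm_apply]
  refine ⟨LinearMap.toContinuousLinearMap (e.symm.toLinearMap ∘ₗ N), ?_, key⟩
  refine ContinuousLinearMap.opNorm_le_bound _ hη fun s => ?_
  have h := (hL (e.symm (N s))).trans ((key s).symm ▸ hN s)
  refine le_of_mul_le_mul_left (h.trans (le_of_eq ?_)) hb
  ring

/-- The constants admissible in the graph transform: maps of norm at most `η` are transformed
into maps of norm at most `η`, and their distances contract. -/
structure IsAdmissible (σ τ η : ℝ) : Prop where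
  σ_nonneg : 0 ≤ σ
  τ_nonneg : 0 ≤ τ
  η_nonneg : 0 ≤ η
  maps : τ + σ * η ≤ η * (1 - τ * η)
  contracts : σ + τ * η < 1 - τ * η

variable {A : U →ₗ[ℝ] U'} {B : S →ₗ[ℝ] U'} {C : U →ₗ[ℝ] S'} {D : S →ₗ[ℝ] S'} {σ τ η : ℝ}

theorem IsAdmissible.gap_pos (hc : IsAdmissible σ τ η) : 0 < 1 - τ * η := by
  have := hc.contracts
  have := mul_nonneg hc.τ_nonneg hc.η_nonneg
  linarith [hc.σ_nonneg]

/-- If `σ < 1`, every slope `η ≤ 1` is admissible as soon as the off-diagonal blocks are small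
relative to `η` and the gap `1 - σ`. -/
theorem isAdmissible (hσ : 0 ≤ σ) (hσ1 : σ < 1) (hη : 0 ≤ η) (hη1 : η ≤ 1) :
    IsAdmissible σ (η * (1 - σ) / 4) η where
  σ_nonneg := hσ
  τ_nonneg := div_nonneg (mul_nonneg hη (sub_nonneg.2 hσ1.le)) (by norm_num)
  η_nonneg := hη
  maps := by
    have h1 : 0 ≤ η * (1 - σ) := mul_nonneg hη (by linarith)
    have h2 : η * η ≤ 1 := mul_le_one₀ hη1 hη hη1
    have h3 := mul_le_mul_of_nonneg_left h2 h1
    linarith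
  contracts := by
    have h2 : η * η ≤ 1 := mul_le_one₀ hη1 hη hη1
    have h3 := mul_le_mul_of_nonneg_left h2 (by linarith : 0 ≤ 1 - σ)
    linarith

/-- A small slope `η` costs less than any prescribed factor `q < 1`. -/
theorem exists_slope_bound {q : ℝ} (hq : q < 1) :
    ∃ η : ℝ, 0 < η ∧ η < 1 ∧ q * (1 + η) ^ 2 ≤ (1 - η) ^ 2 := by
  have hcont : Continuous fun η : ℝ => (1 - η) ^ 2 - q * (1 + η) ^ 2 := by fun_prop
  have h0 : ∀ᶠ η in nhds (0 : ℝ), 0 < (1 - η) ^ 2 - q * (1 + η) ^ 2 :=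
    hcont.continuousAt.eventually_const_lt (by simpa using hq)
  have h1 : ∀ᶠ η in nhdsWithin (0 : ℝ) (Set.Ioi 0), 0 < η ∧ η < 1 :=
    Ioo_mem_nhdsGT one_pos
  obtain ⟨η, hη, hη0, hη1⟩ := ((h0.filter_mono nhdsWithin_le_nhds).and h1).exists
  exact ⟨η, hη0, hη1, (sub_pos.1 hη).le⟩

/-- The contraction factor of the graph transform. -/
noncomputable def contractionFactor (σ τ η : ℝ) : ℝ := (σ + τ * η) / (1 - τ * η)

theorem IsAdmissible.contractionFactor_nonneg (hc : IsAdmissible σ τ η) :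
    0 ≤ contractionFactor σ τ η :=
  div_nonneg (add_nonneg hc.σ_nonneg (mul_nonneg hc.τ_nonneg hc.η_nonneg)) hc.gap_pos.le

theorem IsAdmissible.contractionFactor_lt_one (hc : IsAdmissible σ τ η) :
    contractionFactor σ τ η < 1 := (div_lt_one hc.gap_pos).2 hc.contracts

theorem norm_apply_le_of_le {V W : Type*} [NormedAddCommGroup V] [NormedSpace ℝ V]
    [NormedAddCommGroup W] [NormedSpace ℝ W] {P : V →L[ℝ] W} {η r : ℝ} {v : V} (hP : ‖P‖ ≤ η)
    (hv : ‖v‖ ≤ r) : ‖P v‖ ≤ η * r :=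
  (P.le_opNorm v).trans
    (mul_le_mul hP hv (norm_nonneg _) ((norm_nonneg _).trans hP))

/-- The forward graph transform: the image of the graph of `P : U → S` is the graph of some
`P' : U' → S'`. -/
theorem IsDominated.exists_forward [FiniteDimensional ℝ U] [FiniteDimensional ℝ U']
    (h : IsDominated A B C D σ τ) (hc : IsAdmissible σ τ η)
    {P : U →L[ℝ] S} (hP : ‖P‖ ≤ η) :
    ∃ P' : U' →L[ℝ] S', ‖P'‖ ≤ η ∧ ∀ u, P' (A u + B (P u)) = C u + D (P u) := by
  obtain ⟨a, ha, hA, hB, hC, hD⟩ := h.exists_scale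
  have hPu (u : U) : ‖P u‖ ≤ η * ‖u‖ := P.le_of_opNorm_le hP u
  refine exists_comp_eq (L := A + B ∘ₗ P.toLinearMap) (N := C + D ∘ₗ P.toLinearMap)
    (b := a * (1 - τ * η)) h.finrank_eq (mul_pos ha hc.gap_pos) hc.η_nonneg
    (fun u => ?_) (fun u => ?_)
  · have h1 : ‖B (P u)‖ ≤ τ * a * (η * ‖u‖) :=
      (hB _).trans (mul_le_mul_of_nonneg_left (hPu u) (mul_nonneg hc.τ_nonneg ha.le))
    have h2 := norm_sub_le_norm_add (A u) (B (P u))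
    have h3 := hA u
    simp only [LinearMap.add_apply, LinearMap.comp_apply, ContinuousLinearMap.coe_coe]
    linarith
  · have h1 : ‖D (P u)‖ ≤ σ * a * (η * ‖u‖) :=
      (hD _).trans (mul_le_mul_of_nonneg_left (hPu u) (mul_nonneg hc.σ_nonneg ha.le))
    have h2 := norm_add_le (C u) (D (P u))
    have h3 := hC u
    have h4 := mul_le_mul_of_nonneg_right hc.maps (mul_nonneg ha.le (norm_nonneg u))
    simp only [LinearMap.add_apply, LinearMap.comp_apply, ContinuousLinearMap.coe_coe]
    linarith

/-- At a common point `A u + B (P₁ u)` the two images differ by `D w - P₂' (B w)` with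
`w = (P₁ - P₂) u`, and this is where the gap between `A` and `D` makes the transform contract. -/
theorem IsDominated.forward_contracts [FiniteDimensional ℝ U] [FiniteDimensional ℝ U']
    (h : IsDominated A B C D σ τ) (hc : IsAdmissible σ τ η)
    {P₁ P₂ : U →L[ℝ] S} {P₁' P₂' : U' →L[ℝ] S'} (hP₁ : ‖P₁‖ ≤ η) (hP₂' : ‖P₂'‖ ≤ η)
    (h₁ : ∀ u, P₁' (A u + B (P₁ u)) = C u + D (P₁ u))
    (h₂ : ∀ u, P₂' (A u + B (P₂ u)) = C u + D (P₂ u)) {r : ℝ} (hr : ‖P₁ - P₂‖ ≤ r) :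
    ‖P₁' - P₂'‖ ≤ contractionFactor σ τ η * r := by
  obtain ⟨a, ha, hA, hB, hC, hD⟩ := h.exists_scale
  have hr0 : 0 ≤ r := (norm_nonneg _).trans hr
  have hL (u : U) : a * (1 - τ * η) * ‖u‖ ≤ ‖(A + B ∘ₗ P₁.toLinearMap) u‖ := by
    have h1 : ‖B (P₁ u)‖ ≤ τ * a * (η * ‖u‖) := (hB _).trans
      (mul_le_mul_of_nonneg_left (P₁.le_of_opNorm_le hP₁ u) (mul_nonneg hc.τ_nonneg ha.le))
    have h2 := norm_sub_le_norm_add (A u) (B (P₁ u))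
    have h3 := hA u
    simp only [LinearMap.add_apply, LinearMap.comp_apply, ContinuousLinearMap.coe_coe]
    linarith
  obtain ⟨e, he⟩ := exists_linearEquiv_of_bound h.finrank_eq (mul_pos ha hc.gap_pos) hL
  refine ContinuousLinearMap.opNorm_le_bound _ (mul_nonneg hc.contractionFactor_nonneg hr0)
    fun v => ?_
  obtain ⟨u, rfl⟩ := e.surjective v
  rw [he]
  set w := (P₁ - P₂) u with hw
  have hwr : ‖w‖ ≤ r * ‖u‖ := (P₁ - P₂).le_of_opNorm_le hr u
  have hP₁u : P₁ u = P₂ u + w := by simp [hw]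
  have key : (P₁' - P₂') ((A + B ∘ₗ P₁.toLinearMap) u) = D w - P₂' (B w) := by
    have e1 : A u + B (P₁ u) = (A u + B (P₂ u)) + B w := by rw [hP₁u, map_add, add_assoc]
    simp only [LinearMap.add_apply, LinearMap.comp_apply, ContinuousLinearMap.coe_coe,
      sub_apply]
    rw [h₁ u, e1, map_add P₂', h₂ u, hP₁u, map_add D]
    abel
  have h1 : ‖D w - P₂' (B w)‖ ≤ (σ + τ * η) * a * (r * ‖u‖) := by
    have h1 : ‖D w‖ ≤ σ * a * (r * ‖u‖) :=
      (hD _).trans (mul_le_mul_of_nonneg_left hwr (mul_nonneg hc.σ_nonneg ha.le))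
    have h2 : ‖B w‖ ≤ τ * a * (r * ‖u‖) :=
      (hB _).trans (mul_le_mul_of_nonneg_left hwr (mul_nonneg hc.τ_nonneg ha.le))
    have h3 := norm_apply_le_of_le hP₂' h2
    have h4 := norm_sub_le (D w) (P₂' (B w))
    linarith
  rw [key]
  refine h1.trans ?_
  have h2 := mul_le_mul_of_nonneg_left (hL u) (mul_nonneg hc.contractionFactor_nonneg hr0)
  refine le_trans (le_of_eq ?_) h2
  have := hc.gap_pos.ne'
  unfold contractionFactor
  field_simp

/-- The backward graph transform: the preimage of the graph of `Q' : S' → U'` is the graph of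
some `Q : S → U`. -/
theorem IsDominated.exists_backward [FiniteDimensional ℝ U] [FiniteDimensional ℝ U']
    [FiniteDimensional ℝ S] (h : IsDominated A B C D σ τ) (hc : IsAdmissible σ τ η)
    {Q' : S' →L[ℝ] U'} (hQ' : ‖Q'‖ ≤ η) :
    ∃ Q : S →L[ℝ] U, ‖Q‖ ≤ η ∧ ∀ s, A (Q s) + B s = Q' (C (Q s) + D s) := by
  obtain ⟨a, ha, hA, hB, hC, hD⟩ := h.exists_scale
  obtain ⟨Q, hQ, hQe⟩ := exists_eq_comp (L := A - Q'.toLinearMap ∘ₗ C)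
    (N := Q'.toLinearMap ∘ₗ D - B)
    (b := a * (1 - τ * η)) h.finrank_eq (mul_pos ha hc.gap_pos) hc.η_nonneg
    (fun u => by
      have h1 := norm_apply_le_of_le hQ' (hC u)
      have h2 := norm_sub_norm_le (A u) (Q' (C u))
      have h3 := hA u
      simp only [LinearMap.sub_apply, LinearMap.comp_apply, ContinuousLinearMap.coe_coe]
      linarith)
    (fun s => by
      have h1 := norm_apply_le_of_le hQ' (hD s)
      have h2 := norm_sub_le (Q' (D s)) (B s)
      have h3 := hB s
      have h4 := mul_le_mul_of_nonneg_right hc.maps (mul_nonneg ha.le (norm_nonneg s))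
      simp only [LinearMap.sub_apply, LinearMap.comp_apply, ContinuousLinearMap.coe_coe]
      linarith)
  refine ⟨Q, hQ, fun s => ?_⟩
  have := hQe s
  simp only [LinearMap.sub_apply, LinearMap.comp_apply, ContinuousLinearMap.coe_coe] at this
  rw [map_add, ← sub_eq_zero]
  rw [← sub_eq_zero] at this
  rw [← this]
  abel

/-- The difference `w = (Q₁ - Q₂) s` solves `(A - Q₁' C) w = (Q₁' - Q₂') (C (Q₂ s) + D s)`. -/
theorem IsDominated.backward_contracts (h : IsDominated A B C D σ τ) (hc : IsAdmissible σ τ η)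
    {Q₁ Q₂ : S →L[ℝ] U} {Q₁' Q₂' : S' →L[ℝ] U'} (hQ₂ : ‖Q₂‖ ≤ η) (hQ₁' : ‖Q₁'‖ ≤ η)
    (h₁ : ∀ s, A (Q₁ s) + B s = Q₁' (C (Q₁ s) + D s))
    (h₂ : ∀ s, A (Q₂ s) + B s = Q₂' (C (Q₂ s) + D s)) {r : ℝ} (hr : ‖Q₁' - Q₂'‖ ≤ r) :
    ‖Q₁ - Q₂‖ ≤ contractionFactor σ τ η * r := by
  obtain ⟨a, ha, hA, hB, hC, hD⟩ := h.exists_scale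
  have hr0 : 0 ≤ r := (norm_nonneg _).trans hr
  refine ContinuousLinearMap.opNorm_le_bound _ (mul_nonneg hc.contractionFactor_nonneg hr0)
    fun s => ?_
  set w := (Q₁ - Q₂) s with hw
  have hQ₁s : Q₁ s = Q₂ s + w := by simp [hw]
  have key : A w - Q₁' (C w) = (Q₁' - Q₂') (C (Q₂ s) + D s) := by
    have e1 := h₁ s
    have e2 := h₂ s
    rw [hQ₁s] at e1
    simp only [map_add] at e1 e2
    simp only [map_add, sub_apply]
    rw [← sub_eq_zero] at e1 e2 ⊢
    rw [← sub_eq_zero.2 (e1.trans e2.symm)]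
    abel
  have h1 : ‖(Q₁' - Q₂') (C (Q₂ s) + D s)‖ ≤ r * ((σ + τ * η) * a * ‖s‖) := by
    refine norm_apply_le_of_le hr ?_
    have h1 : ‖C (Q₂ s)‖ ≤ τ * a * (η * ‖s‖) := (hC _).trans
      (mul_le_mul_of_nonneg_left (Q₂.le_of_opNorm_le hQ₂ s) (mul_nonneg hc.τ_nonneg ha.le))
    have h2 := norm_add_le (C (Q₂ s)) (D s)
    have h3 := hD s
    linarith
  have h2 : a * (1 - τ * η) * ‖w‖ ≤ ‖A w - Q₁' (C w)‖ := by
    have h1 := norm_apply_le_of_le hQ₁' (hC w)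
    have h2 := norm_sub_norm_le (A w) (Q₁' (C w))
    have h3 := hA w
    linarith
  rw [key] at h2
  refine le_of_mul_le_mul_left ((h2.trans h1).trans (le_of_eq ?_)) (mul_pos ha hc.gap_pos)
  have := hc.gap_pos.ne'
  unfold contractionFactor
  field_simp

end GraphTransform

/-! ### Invariant graphs of a dominated cocycle -/

section InvariantGraphs

variable {ι : Type*} {U S : ι → Type*}
  [∀ i, NormedAddCommGroup (U i)] [∀ i, NormedSpace ℝ (U i)] [∀ i, FiniteDimensional ℝ (U i)]
  [∀ i, NormedAddCommGroup (S i)] [∀ i, NormedSpace ℝ (S i)] [∀ i, FiniteDimensional ℝ (S i)]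
  {f : ι → ι} {A : ∀ i, U i →ₗ[ℝ] U (f i)} {B : ∀ i, S i →ₗ[ℝ] U (f i)}
  {C : ∀ i, U i →ₗ[ℝ] S (f i)} {D : ∀ i, S i →ₗ[ℝ] S (f i)} {σ τ η : ℝ}

/-- Over a set `Λ` on which the cocycle is dominated there are graphs over `U` that the cocycle
carries to each other. At points outside `f '' Λ` the forward transform has no value, and the
zero map is prescribed there. -/
theorem exists_invariant_graph_forward (hf : Function.Bijective f) (Λ : Set ι)
    (h : ∀ i ∈ Λ, IsDominated (A i) (B i) (C i) (D i) σ τ) (hc : IsAdmissible σ τ η) :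
    ∃ P : ∀ i, U i →L[ℝ] S i, (∀ i, ‖P i‖ ≤ η) ∧
      ∀ i ∈ Λ, ∀ u, P (f i) (A i u + B i (P i u)) = C i u + D i (P i u) := by
  classical
  -- The fixed point argument needs a total transform; outside the `η`-ball its values are
  -- arbitrary.
  have hstep (i : ι) (P : U i →L[ℝ] S i) : ∃ P' : U (f i) →L[ℝ] S (f i), ‖P‖ ≤ η →
      ‖P'‖ ≤ η ∧ (i ∈ Λ → ∀ u, P' (A i u + B i (P u)) = C i u + D i (P u)) ∧
        (i ∉ Λ → P' = 0) := by
    by_cases hP : ‖P‖ ≤ η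
    · by_cases hi : i ∈ Λ
      · obtain ⟨P', hP', hinv⟩ := (h i hi).exists_forward hc hP
        exact ⟨P', fun _ => ⟨hP', fun _ => hinv, fun hn => absurd hi hn⟩⟩
      · exact ⟨0, fun _ => ⟨by simpa using hc.η_nonneg, fun hn => absurd hn hi, fun _ => rfl⟩⟩
    · exact ⟨0, fun hP' => absurd hP' hP⟩
  choose Γ hΓ using hstep
  let T : (∀ i, U i →L[ℝ] S i) → ∀ i, U i →L[ℝ] S i := fun P =>
    Equiv.piCongrLeft (fun i => U i →L[ℝ] S i) (Equiv.ofBijective f hf) fun i => Γ i (P i)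
  have hT (P : ∀ i, U i →L[ℝ] S i) (i : ι) : T P (f i) = Γ i (P i) :=
    Equiv.piCongrLeft_apply_apply (fun i => U i →L[ℝ] S i) (Equiv.ofBijective f hf) _ i
  obtain ⟨P, hP, hfix⟩ := exists_fixed_section T hc.η_nonneg hc.contractionFactor_nonneg
    hc.contractionFactor_lt_one
    (fun P hP j => by
      obtain ⟨i, rfl⟩ := hf.surjective j
      rw [hT]
      exact (hΓ i (P i) (hP i)).1)
    (fun P P' hP hP' r hr0 hr j => by
      obtain ⟨i, rfl⟩ := hf.surjective j
      rw [hT, hT]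
      obtain ⟨-, h1, h1'⟩ := hΓ i (P i) (hP i)
      obtain ⟨h2n, h2, h2'⟩ := hΓ i (P' i) (hP' i)
      by_cases hi : i ∈ Λ
      · exact (h i hi).forward_contracts hc (hP i) h2n (h1 hi) (h2 hi) (hr i)
      · rw [h1' hi, h2' hi, sub_zero, norm_zero]
        exact mul_nonneg hc.contractionFactor_nonneg hr0)
  refine ⟨P, hP, fun i hi u => ?_⟩
  rw [← (hΓ i (P i) (hP i)).2.1 hi u, ← hT, hfix]

/-- Over a set `Λ` on which the cocycle is dominated there are graphs over `S` that the cocycle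
carries into each other. -/
theorem exists_invariant_graph_backward (Λ : Set ι)
    (h : ∀ i ∈ Λ, IsDominated (A i) (B i) (C i) (D i) σ τ) (hc : IsAdmissible σ τ η) :
    ∃ Q : ∀ i, S i →L[ℝ] U i, (∀ i, ‖Q i‖ ≤ η) ∧
      ∀ i ∈ Λ, ∀ s, A i (Q i s) + B i s = Q (f i) (C i (Q i s) + D i s) := by
  classical
  have hstep (i : ι) (Q' : S (f i) →L[ℝ] U (f i)) : ∃ Q : S i →L[ℝ] U i, ‖Q'‖ ≤ η →
      ‖Q‖ ≤ η ∧ (i ∈ Λ → ∀ s, A i (Q s) + B i s = Q' (C i (Q s) + D i s)) ∧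
        (i ∉ Λ → Q = 0) := by
    by_cases hQ' : ‖Q'‖ ≤ η
    · by_cases hi : i ∈ Λ
      · obtain ⟨Q, hQ, hinv⟩ := (h i hi).exists_backward hc hQ'
        exact ⟨Q, fun _ => ⟨hQ, fun _ => hinv, fun hn => absurd hi hn⟩⟩
      · exact ⟨0, fun _ => ⟨by simpa using hc.η_nonneg, fun hn => absurd hn hi, fun _ => rfl⟩⟩
    · exact ⟨0, fun h' => absurd h' hQ'⟩
  choose Γ hΓ using hstep
  obtain ⟨Q, hQ, hfix⟩ := exists_fixed_section (V := fun i => S i →L[ℝ] U i)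
    (fun Q i => Γ i (Q (f i))) hc.η_nonneg
    hc.contractionFactor_nonneg hc.contractionFactor_lt_one
    (fun Q hQ i => (hΓ i (Q (f i)) (hQ (f i))).1)
    (fun Q Q' hQ hQ' r hr0 hr i => by
      obtain ⟨-, h1, h1'⟩ := hΓ i (Q (f i)) (hQ (f i))
      obtain ⟨h2n, h2, h2'⟩ := hΓ i (Q' (f i)) (hQ' (f i))
      by_cases hi : i ∈ Λ
      · exact (h i hi).backward_contracts hc h2n (hQ (f i)) (h1 hi) (h2 hi) (hr (f i))
      · rw [h1' hi, h2' hi, sub_zero, norm_zero]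
        exact mul_nonneg hc.contractionFactor_nonneg hr0)
  refine ⟨Q, hQ, fun i hi s => ?_⟩
  have h1 := (hΓ i (Q (f i)) (hQ (f i))).2.1 hi s
  rwa [show Γ i (Q (f i)) = Q i from congrFun hfix i] at h1

end InvariantGraphs

/-! ### Derivatives on compact Riemannian manifolds -/

section DerivativeBounds

variable {E : Type*} [NormedAddCommGroup E] [NormedSpace ℝ E]
  {M : Type*} [TopologicalSpace M] [ChartedSpace E M] [IsManifold 𝓘(ℝ, E) 1 M]
  [RiemannianBundle (fun x : M => TangentSpace 𝓘(ℝ, E) x)]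
  [IsContinuousRiemannianBundle E (fun x : M => TangentSpace 𝓘(ℝ, E) x)]

/-- In trivializations the derivative is continuous, and the trivializations are locally bounded
with respect to the Riemannian norms. -/
theorem eventually_norm_mfderiv_le {g : M → M} (hg : ContMDiff 𝓘(ℝ, E) 𝓘(ℝ, E) 1 g) (x : M) :
    ∃ K : ℝ, 0 < K ∧ ∀ᶠ y in nhds x, ∀ v : TangentSpace 𝓘(ℝ, E) y,
      ‖mfderiv 𝓘(ℝ, E) 𝓘(ℝ, E) g y v‖ ≤ K * ‖v‖ := by
  obtain ⟨K₁, hK₁, h₁⟩ :=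
    eventually_norm_trivializationAt_lt E (fun x : M => TangentSpace 𝓘(ℝ, E) x) x
  obtain ⟨K₂, hK₂, h₂⟩ :=
    eventually_norm_symmL_trivializationAt_lt E (fun x : M => TangentSpace 𝓘(ℝ, E) x) (g x)
  have hcont := ((hg x).mfderiv_const (m := 0) (by simp)).continuousAt
  set N : M → E →L[ℝ] E :=
    inTangentCoordinates 𝓘(ℝ, E) 𝓘(ℝ, E) id g (mfderiv 𝓘(ℝ, E) 𝓘(ℝ, E) g) x
  have h₃ : ∀ᶠ y in nhds x, ‖N y‖ < ‖N x‖ + 1 :=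
    hcont.norm.eventually_lt_const (lt_add_one _)
  have hgx := hg.continuous.continuousAt (x := x)
  refine ⟨K₂ * ((‖N x‖ + 1) * K₁), by positivity, ?_⟩
  filter_upwards [h₁, hgx.eventually h₂, h₃, chart_source_mem_nhds E x,
    hgx.eventually (chart_source_mem_nhds E (g x))] with y h₁ h₂ h₃ hy hgy v
  have key : mfderiv 𝓘(ℝ, E) 𝓘(ℝ, E) g y v =
      (trivializationAt E (TangentSpace 𝓘(ℝ, E)) (g x)).symmL ℝ (g y)
        (N y ((trivializationAt E (TangentSpace 𝓘(ℝ, E)) x).continuousLinearMapAt ℝ y v)) := by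
    have e : N y = ContinuousLinearMap.inCoordinates E (TangentSpace 𝓘(ℝ, E)) E
        (TangentSpace 𝓘(ℝ, E)) x y (g x) (g y) (mfderiv 𝓘(ℝ, E) 𝓘(ℝ, E) g y) := rfl
    have hy' : y ∈ (trivializationAt E (TangentSpace 𝓘(ℝ, E)) x).baseSet := hy
    have hgy' : g y ∈ (trivializationAt E (TangentSpace 𝓘(ℝ, E)) (g x)).baseSet := hgy
    rw [e, ContinuousLinearMap.inCoordinates_eq hy' hgy',
      Trivialization.coe_continuousLinearEquivAt_eq',
      Trivialization.symm_continuousLinearEquivAt_eq', ContinuousLinearMap.comp_apply,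
      ContinuousLinearMap.comp_apply, Trivialization.symmL_continuousLinearMapAt _ hgy',
      Trivialization.symmL_continuousLinearMapAt _ hy']
  rw [key]
  refine ((ContinuousLinearMap.le_of_opNorm_le _ h₂.le _)).trans ?_
  have a := ContinuousLinearMap.le_of_opNorm_le _ h₁.le v
  have b := ContinuousLinearMap.le_of_opNorm_le _ h₃.le
    ((trivializationAt E (TangentSpace 𝓘(ℝ, E)) x).continuousLinearMapAt ℝ y v)
  rw [mul_assoc K₂]
  refine mul_le_mul_of_nonneg_left (b.trans ?_) hK₂.le
  rw [mul_assoc]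
  exact mul_le_mul_of_nonneg_left a (by positivity)

/-- A `C^1` self-map of a compact Riemannian manifold has bounded derivative. -/
theorem exists_norm_mfderiv_le [CompactSpace M] {g : M → M}
    (hg : ContMDiff 𝓘(ℝ, E) 𝓘(ℝ, E) 1 g) :
    ∃ K : ℝ, 0 < K ∧ ∀ (x : M) (v : TangentSpace 𝓘(ℝ, E) x),
      ‖mfderiv 𝓘(ℝ, E) 𝓘(ℝ, E) g x v‖ ≤ K * ‖v‖ := by
  choose K hK hKx using eventually_norm_mfderiv_le hg
  obtain ⟨t, ht⟩ := CompactSpace.elim_nhds_subcover _ hKx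
  refine ⟨1 + ∑ x ∈ t, K x, by have := Finset.sum_nonneg fun x (_ : x ∈ t) => (hK x).le; linarith,
    fun y v => ?_⟩
  obtain ⟨x, hx, hy⟩ : ∃ x ∈ t, y ∈ {y | ∀ v : TangentSpace 𝓘(ℝ, E) y,
      ‖mfderiv 𝓘(ℝ, E) 𝓘(ℝ, E) g y v‖ ≤ K x * ‖v‖} := by
    have : y ∈ ⋃ x ∈ t, {y | ∀ v : TangentSpace 𝓘(ℝ, E) y,
      ‖mfderiv 𝓘(ℝ, E) 𝓘(ℝ, E) g y v‖ ≤ K x * ‖v‖} := ht ▸ trivial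
    simpa using this
  refine (hy v).trans (mul_le_mul_of_nonneg_right ?_ (norm_nonneg v))
  have := Finset.single_le_sum (f := K) (fun z _ => (hK z).le) hx
  linarith

/-- A `C^1` diffeomorphism of a compact Riemannian manifold expands tangent vectors by at least
a uniform positive factor. -/
theorem exists_le_norm_mfderiv [CompactSpace M] (f : M ≃ₘ^1⟮𝓘(ℝ, E), 𝓘(ℝ, E)⟯ M) :
    ∃ c : ℝ, 0 < c ∧ ∀ (x : M) (v : TangentSpace 𝓘(ℝ, E) x),
      c * ‖v‖ ≤ ‖mfderiv 𝓘(ℝ, E) 𝓘(ℝ, E) f x v‖ := by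
  obtain ⟨K, hK, hKx⟩ := exists_norm_mfderiv_le f.symm.contMDiff
  refine ⟨K⁻¹, inv_pos.2 hK, fun x v => ?_⟩
  rw [inv_mul_le_iff₀ hK]
  have hinj : mfderiv 𝓘(ℝ, E) 𝓘(ℝ, E) f.symm (f x) (mfderiv 𝓘(ℝ, E) 𝓘(ℝ, E) f x v) = v := by
    have h := mfderiv_comp x ((f.symm.contMDiff (f x)).mdifferentiableAt one_ne_zero)
      ((f.contMDiff x).mdifferentiableAt one_ne_zero)
    have hid : (f.symm : M → M) ∘ f = id := funext f.symm_apply_apply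
    rw [hid, mfderiv_id] at h
    exact (DFunLike.congr_fun h v).symm
  -- The fibres over `f.symm (f x)` and `x` agree only propositionally, and so do their norms.
  have hnorm (y : M) (h : y = x) (w : TangentSpace 𝓘(ℝ, E) y) (hw : w = (v : E)) :
      ‖w‖ = ‖v‖ := by
    subst h; rw [hw]
  exact (hnorm _ (f.symm_apply_apply x) _ hinj).symm.trans_le (hKx (f x) _)

end DerivativeBounds

/-- A smooth Riemannian metric is continuous. -/
theorem isContinuousRiemannianBundle {E : Type*} [NormedAddCommGroup E] [NormedSpace ℝ E]
    {M : Type*} [TopologicalSpace M] [ChartedSpace E M] [IsManifold 𝓘(ℝ, E) ∞ M]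
    [IsManifold 𝓘(ℝ, E) 1 M] [RiemannianBundle (fun x : M => TangentSpace 𝓘(ℝ, E) x)]
    [h : IsContMDiffRiemannianBundle 𝓘(ℝ, E) ∞ E (fun x : M => TangentSpace 𝓘(ℝ, E) x)] :
    IsContinuousRiemannianBundle E (fun x : M => TangentSpace 𝓘(ℝ, E) x) := by
  obtain ⟨g, hg, hgv⟩ := h.exists_contMDiff
  exact ⟨g, hg.continuous, hgv⟩

/-! ### Operator norm and minimum norm -/

section Norms

variable {V W : Type*} [NormedAddCommGroup V] [NormedSpace ℝ V]
  [NormedAddCommGroup W] [NormedSpace ℝ W]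

theorem norm_le_opNorm_mul [FiniteDimensional ℝ V] (T : V →ₗ[ℝ] W) (v : V) :
    ‖T v‖ ≤ opNorm T * ‖v‖ :=
  (LinearMap.toContinuousLinearMap T).le_opNorm v

theorem opNorm_nonneg [FiniteDimensional ℝ V] (T : V →ₗ[ℝ] W) : 0 ≤ opNorm T :=
  norm_nonneg (LinearMap.toContinuousLinearMap T)

theorem opNorm_le [FiniteDimensional ℝ V] {T : V →ₗ[ℝ] W} {b : ℝ} (hb : 0 ≤ b)
    (h : ∀ v, ‖T v‖ ≤ b * ‖v‖) : opNorm T ≤ b :=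
  ContinuousLinearMap.opNorm_le_bound _ hb h

theorem ofReal_le_minNorm {T : V →ₗ[ℝ] W} {b : ℝ} (h : ∀ v, b * ‖v‖ ≤ ‖T v‖) :
    ENNReal.ofReal b ≤ minNorm T := by
  refine le_iInf₂ fun v hv => ?_
  rw [ENNReal.le_div_iff_mul_le (Or.inl (by simpa using hv)) (Or.inl (by simp)),
    ← ofReal_norm, ← ofReal_norm, ← ENNReal.ofReal_mul' (norm_nonneg v)]
  exact ENNReal.ofReal_le_ofReal (h v)

theorem minNorm_mul_enorm_le {T : V →ₗ[ℝ] W} {v : V} (hv : v ≠ 0) :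
    minNorm T * ‖v‖ₑ ≤ ‖T v‖ₑ := by
  rw [← ENNReal.le_div_iff_mul_le (Or.inl (by simpa using hv)) (Or.inl (by simp))]
  exact iInf₂_le v hv

/-- For `minNorm T = ⊤` this holds with the junk value `0` of `toReal`. -/
theorem minNorm_toReal_mul_norm_le (T : V →ₗ[ℝ] W) (v : V) :
    (minNorm T).toReal * ‖v‖ ≤ ‖T v‖ := by
  rcases eq_or_ne v 0 with rfl | hv
  · simp
  · have h := ENNReal.toReal_mono (by simp) (minNorm_mul_enorm_le (T := T) hv)
    simpa using h

theorem eq_zero_of_minNorm_eq_top {T : V →ₗ[ℝ] W} (hT : minNorm T = ⊤) (v : V) : v = 0 := by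
  by_contra hv
  have h := minNorm_mul_enorm_le (T := T) hv
  rw [hT, ENNReal.top_mul (by simpa using hv)] at h
  simp at h

end Norms

/-! ### Graphs over the summands of a splitting -/

section Graphs

variable {V V' : Type*} [NormedAddCommGroup V] [NormedSpace ℝ V]
  [NormedAddCommGroup V'] [NormedSpace ℝ V']

/-- The graph `{u + P u : u ∈ U}` of a linear map between two subspaces of `V`, as a subspace
of `V`. -/
def graphOver {U S : Submodule ℝ V} (P : U →L[ℝ] S) : Submodule ℝ V :=
  LinearMap.range (U.subtype + S.subtype ∘ₗ P.toLinearMap)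

theorem mem_graphOver {U S : Submodule ℝ V} {P : U →L[ℝ] S} {w : V} :
    w ∈ graphOver P ↔ ∃ u : U, (u : V) + P u = w := by
  simp [graphOver]

variable {U S : Submodule ℝ V} {η : ℝ}

theorem norm_add_apply_le {P : U →L[ℝ] S} (hP : ‖P‖ ≤ η) (u : U) :
    ‖(u : V) + P u‖ ≤ (1 + η) * ‖u‖ := by
  have h1 := norm_add_le (u : V) (P u)
  have h2 := P.le_of_opNorm_le hP u
  simp only [Submodule.coe_norm] at *
  linarith

theorem le_norm_add_apply {P : U →L[ℝ] S} (hP : ‖P‖ ≤ η) (u : U) :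
    (1 - η) * ‖u‖ ≤ ‖(u : V) + P u‖ := by
  have h1 := norm_sub_le_norm_add (u : V) (P u)
  have h2 := P.le_of_opNorm_le hP u
  simp only [Submodule.coe_norm] at *
  linarith

theorem finrank_graphOver (h : Disjoint U S) (P : U →L[ℝ] S) :
    Module.finrank ℝ (graphOver P) = Module.finrank ℝ U := by
  refine LinearMap.finrank_range_of_inj ((injective_iff_map_eq_zero _).2 fun u hu => ?_)
  have h1 : (u : V) = ((-P u : S) : V) := by
    simpa [eq_neg_iff_add_eq_zero] using hu
  exact Subtype.ext (Submodule.disjoint_def.1 h u u.2 (h1 ▸ (-P u).2))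

/-- Graphs of contractions in the two directions of a splitting form a splitting again. -/
theorem isCompl_graphOver [FiniteDimensional ℝ V] (h : IsCompl U S) {P : U →L[ℝ] S}
    {Q : S →L[ℝ] U} (hP : ‖P‖ ≤ η) (hQ : ‖Q‖ ≤ η) (hη : η < 1) :
    IsCompl (graphOver P) (graphOver Q) := by
  rw [Submodule.isCompl_iff_disjoint, Submodule.disjoint_def]
  · intro w hw hw'
    obtain ⟨u, rfl⟩ := mem_graphOver.1 hw
    obtain ⟨s, hs⟩ := mem_graphOver.1 hw'
    -- Comparing components gives `u = Q s` and `s = P u`.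
    have hdiff : ((u - Q s : U) : V) = ((s - P u : S) : V) := by
      push_cast
      rw [sub_eq_sub_iff_add_eq_add, hs]
    have h0 := Submodule.disjoint_def.1 h.disjoint _ (u - Q s).2 (hdiff ▸ (s - P u).2)
    have hu : u = Q s := sub_eq_zero.1 (Subtype.ext h0)
    have hsP : s = P u := sub_eq_zero.1 (Subtype.ext (hdiff.symm.trans h0))
    have h1 : ‖u‖ ≤ η * ‖s‖ := by
      conv_lhs => rw [hu]
      exact Q.le_of_opNorm_le hQ s
    have h2 : ‖s‖ ≤ η * ‖u‖ := by
      conv_lhs => rw [hsP]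
      exact P.le_of_opNorm_le hP u
    have hη0 : 0 ≤ η := (norm_nonneg P).trans hP
    have hu0 : u = 0 := by
      rw [← norm_le_zero_iff]
      by_contra hpos
      push Not at hpos
      have h3 : ‖s‖ ≤ ‖u‖ := h2.trans (mul_le_of_le_one_left hpos.le hη.le)
      have h4 := mul_le_mul_of_nonneg_left h3 hη0
      have h5 := mul_lt_of_lt_one_left hpos hη
      linarith
    simp [hu0]
  · rw [finrank_graphOver h.disjoint, finrank_graphOver h.disjoint.symm,
      Submodule.finrank_add_eq_of_isCompl h]

variable {U' S' : Submodule ℝ V'} {T : V →ₗ[ℝ] V'} {A : U →ₗ[ℝ] U'} {B : S →ₗ[ℝ] U'}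
  {C : U →ₗ[ℝ] S'} {D : S →ₗ[ℝ] S'}

/-- If the graph transform sends `P` to `P'`, then `T` maps the graph of `P` into that of `P'` and
acts on the base as `A + B P`. -/
theorem map_graph_eq (hU : ∀ u : U, T u = A u + C u) (hS : ∀ s : S, T s = B s + D s)
    {P : U →L[ℝ] S} {P' : U' →L[ℝ] S'}
    (hinv : ∀ u, P' (A u + B (P u)) = C u + D (P u)) (u : U) :
    T ((u : V) + P u) = ((A u + B (P u) : U') : V') + P' (A u + B (P u)) := by
  rw [hinv, map_add, hU, hS]
  push_cast
  abel

/-- On an invariant graph over the expanding direction, `T` expands almost as much as `A`. -/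
theorem mul_norm_le_norm_map_graph (hU : ∀ u : U, T u = A u + C u)
    (hS : ∀ s : S, T s = B s + D s) {P : U →L[ℝ] S} {P' : U' →L[ℝ] S'} (hP : ‖P‖ ≤ η)
    (hP' : ‖P'‖ ≤ η) (hη : η ≤ 1) {ε : ℝ} (hB : ∀ s, ‖B s‖ ≤ ε * ‖s‖)
    (hA : ∀ u, ε * ‖u‖ ≤ ‖A u‖) (hε : 0 ≤ ε)
    (hinv : ∀ u, P' (A u + B (P u)) = C u + D (P u)) (u : U) :
    (1 - η) ^ 2 * ‖A u‖ ≤ ‖T ((u : V) + P u)‖ := by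
  have hη0 : 0 ≤ η := (norm_nonneg P).trans hP
  have h1 : ‖B (P u)‖ ≤ η * ‖A u‖ := calc
    ‖B (P u)‖ ≤ ε * (η * ‖u‖) :=
      (hB _).trans (mul_le_mul_of_nonneg_left (P.le_of_opNorm_le hP u) hε)
    _ = η * (ε * ‖u‖) := by ring
    _ ≤ η * ‖A u‖ := mul_le_mul_of_nonneg_left (hA u) hη0
  have h2 := norm_sub_le_norm_add (A u) (B (P u))
  have h3 := le_norm_add_apply hP' (A u + B (P u))
  rw [map_graph_eq hU hS hinv]
  refine le_trans ?_ h3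
  rw [pow_two, mul_assoc]
  exact mul_le_mul_of_nonneg_left (by linarith) (by linarith)

/-- On an invariant graph over the contracting direction, `T` expands little more than `D`. -/
theorem norm_map_graph_le (hU : ∀ u : U, T u = A u + C u) (hS : ∀ s : S, T s = B s + D s)
    {Q : S →L[ℝ] U} {Q' : S' →L[ℝ] U'} (hQ : ‖Q‖ ≤ η) (hQ' : ‖Q'‖ ≤ η) {ε : ℝ}
    (hC : ∀ u, ‖C u‖ ≤ ε * ‖u‖) (hD : ∀ s, ε * ‖s‖ ≤ ‖D s‖) (hε : 0 ≤ ε)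
    (hinv : ∀ s, A (Q s) + B s = Q' (C (Q s) + D s)) (s : S) :
    ‖T ((s : V) + Q s)‖ ≤ (1 + η) ^ 2 * ‖D s‖ := by
  have hη0 : 0 ≤ η := (norm_nonneg Q).trans hQ
  have h1 : ‖C (Q s)‖ ≤ η * ‖D s‖ := calc
    ‖C (Q s)‖ ≤ ε * (η * ‖s‖) :=
      (hC _).trans (mul_le_mul_of_nonneg_left (Q.le_of_opNorm_le hQ s) hε)
    _ = η * (ε * ‖s‖) := by ring
    _ ≤ η * ‖D s‖ := mul_le_mul_of_nonneg_left (hD s) hη0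
  have h2 := norm_add_le (D s) (C (Q s))
  have hinv' : ∀ s, Q' (D s + C (Q s)) = B s + A (Q s) := fun s => by
    rw [add_comm (D s), ← hinv, add_comm]
  have h3 := norm_add_apply_le hQ' (D s + C (Q s))
  rw [map_graph_eq (fun s => (hS s).trans (add_comm _ _))
    (fun u => (hU u).trans (add_comm _ _)) hinv']
  refine h3.trans ?_
  rw [pow_two, mul_assoc]
  exact mul_le_mul_of_nonneg_left (by linarith) (by linarith)

/-- Small off-diagonal blocks leave a lower bound for the diagonal blocks of an injective map. -/
theorem le_norm_of_le_norm_map {c ε : ℝ} (hT : ∀ v, c * ‖v‖ ≤ ‖T v‖)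
    (hU : ∀ u : U, T u = A u + C u) (hC : ∀ u, ‖C u‖ ≤ ε * ‖u‖) (u : U) :
    (c - ε) * ‖u‖ ≤ ‖A u‖ := by
  have h1 := hT u
  have h2 := hC u
  have h3 := norm_add_le (A u : V') (C u)
  rw [hU] at h1
  simp only [Submodule.coe_norm] at *
  linarith

/-- Small off-diagonal blocks and a gap between `‖D‖` and `m(A)` make a uniformly injective map
dominated. -/
theorem isDominated_of_ratio [FiniteDimensional ℝ V] [FiniteDimensional ℝ V']
    (h : IsCompl U S) (h' : IsCompl U' S') (hdim : Module.finrank ℝ V = Module.finrank ℝ V')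
    {c ε σ τ : ℝ} (hc : 0 < c) (hσ : 0 < σ) (hτ : 0 ≤ τ) (hτ1 : τ ≤ 1)
    (hε : ε ≤ τ * (c / 2)) (hT : ∀ v, c * ‖v‖ ≤ ‖T v‖) (hU : ∀ u : U, T u = A u + C u)
    (hS : ∀ s : S, T s = B s + D s) (hB : opNorm B ≤ ε) (hC : opNorm C ≤ ε)
    (hratio : ENNReal.ofReal (opNorm D) / minNorm A ≤ ENNReal.ofReal σ) :
    IsDominated A B C D σ τ := by
  have hεc : c / 2 ≤ c - ε := by
    have := mul_le_mul_of_nonneg_right hτ1 (by linarith : 0 ≤ c / 2)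
    linarith
  have hBs (s : S) : ‖B s‖ ≤ ε * ‖s‖ :=
    (norm_le_opNorm_mul B s).trans (mul_le_mul_of_nonneg_right hB (norm_nonneg s))
  have hCu (u : U) : ‖C u‖ ≤ ε * ‖u‖ :=
    (norm_le_opNorm_mul C u).trans (mul_le_mul_of_nonneg_right hC (norm_nonneg u))
  have hAu (u : U) : c / 2 * ‖u‖ ≤ ‖A u‖ :=
    (mul_le_mul_of_nonneg_right hεc (norm_nonneg u)).trans (le_norm_of_le_norm_map hT hU hCu u)
  have hDs (s : S) : c / 2 * ‖s‖ ≤ ‖D s‖ :=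
    (mul_le_mul_of_nonneg_right hεc (norm_nonneg s)).trans
      (le_norm_of_le_norm_map hT (fun s => (hS s).trans (add_comm _ _)) hBs s)
  refine ⟨?_, ?_⟩
  · have h1 := LinearMap.finrank_le_finrank_of_injective (injective_of_bound (half_pos hc) hAu)
    have h2 := LinearMap.finrank_le_finrank_of_injective (injective_of_bound (half_pos hc) hDs)
    have h3 := Submodule.finrank_add_eq_of_isCompl h
    have h4 := Submodule.finrank_add_eq_of_isCompl h'
    omega
  · obtain ⟨a, hca, hAa, hDa⟩ : ∃ a : ℝ, c / 2 ≤ a ∧ (∀ u, a * ‖u‖ ≤ ‖A u‖) ∧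
        opNorm D ≤ σ * a := by
      by_cases htop : minNorm A = ⊤
      · -- Here `U` is the zero space and any large `a` will do.
        refine ⟨max (c / 2) (opNorm D / σ), le_max_left _ _, fun u => ?_, ?_⟩
        · simp [eq_zero_of_minNorm_eq_top htop u]
        · have := mul_le_mul_of_nonneg_left (le_max_right (c / 2) (opNorm D / σ)) hσ.le
          rwa [mul_div_cancel₀ _ hσ.ne'] at this
      · have hle : ENNReal.ofReal (c / 2) ≤ minNorm A := ofReal_le_minNorm hAu
        have hpos : minNorm A ≠ 0 :=
          ((ENNReal.ofReal_pos.2 (half_pos hc)).trans_le hle).ne'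
        refine ⟨(minNorm A).toReal, (ENNReal.ofReal_le_iff_le_toReal htop).1 hle,
          minNorm_toReal_mul_norm_le A, ?_⟩
        rw [ENNReal.div_le_iff hpos htop, ← ENNReal.ofReal_toReal htop,
          ← ENNReal.ofReal_mul hσ.le] at hratio
        exact (ENNReal.ofReal_le_ofReal_iff (by positivity)).1 hratio
    have hεa : ε ≤ τ * a := hε.trans (mul_le_mul_of_nonneg_left hca hτ)
    exact ⟨a, (half_pos hc).trans_le hca, hAa,
      fun s => (hBs s).trans (mul_le_mul_of_nonneg_right hεa (norm_nonneg s)),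
      fun u => (hCu u).trans (mul_le_mul_of_nonneg_right hεa (norm_nonneg u)),
      fun s => (norm_le_opNorm_mul D s).trans
        (mul_le_mul_of_nonneg_right hDa (norm_nonneg s))⟩

end Graphs

/-! ### Invariant splittings and their rates -/

section Blocks

variable {E : Type*} [NormedAddCommGroup E] [NormedSpace ℝ E]
  {M : Type*} [TopologicalSpace M] [ChartedSpace E M]
  {f : M → M} {G : TangentSplitting E M} {x : M}

theorem TangentSplitting.projU_add_projS (G : TangentSplitting E M) (x : M)
    (v : TangentSpace 𝓘(ℝ, E) x) :
    (G.projU x v : TangentSpace 𝓘(ℝ, E) x) + G.projS x v = v :=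
  Submodule.projection_add_projection_eq_self (G.isCompl x) v

theorem mfderiv_u (u : G.u x) :
    mfderiv 𝓘(ℝ, E) 𝓘(ℝ, E) f x u =
      (blockA f G x u : TangentSpace 𝓘(ℝ, E) (f x)) + blockC f G x u :=
  (G.projU_add_projS (f x) _).symm

theorem mfderiv_s (s : G.s x) :
    mfderiv 𝓘(ℝ, E) 𝓘(ℝ, E) f x s =
      (blockB f G x s : TangentSpace 𝓘(ℝ, E) (f x)) + blockD f G x s :=
  (G.projU_add_projS (f x) _).symm

/-- The derivative of `f` at `x` maps the splitting at `x` into the splitting at `f x`. -/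
structure IsInvariantAt (f : M → M) (G : TangentSplitting E M) (x : M) : Prop where
  u : ∀ w ∈ G.u x, mfderiv 𝓘(ℝ, E) 𝓘(ℝ, E) f x w ∈ G.u (f x)
  s : ∀ w ∈ G.s x, mfderiv 𝓘(ℝ, E) 𝓘(ℝ, E) f x w ∈ G.s (f x)

theorem IsInvariantAt.coe_blockA (h : IsInvariantAt f G x) (w : G.u x) :
    (blockA f G x w : TangentSpace 𝓘(ℝ, E) (f x)) = mfderiv 𝓘(ℝ, E) 𝓘(ℝ, E) f x w :=
  congrArg Subtype.val (Submodule.projectionOnto_apply_of_mem_left (G.isCompl (f x)) (h.u w w.2))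

theorem IsInvariantAt.coe_blockD (h : IsInvariantAt f G x) (w : G.s x) :
    (blockD f G x w : TangentSpace 𝓘(ℝ, E) (f x)) = mfderiv 𝓘(ℝ, E) 𝓘(ℝ, E) f x w :=
  congrArg Subtype.val
    (Submodule.projectionOnto_apply_of_mem_left (G.isCompl (f x)).symm (h.s w w.2))

theorem IsInvariantAt.blockC_eq_zero (h : IsInvariantAt f G x) : blockC f G x = 0 :=
  LinearMap.ext fun w =>
    (Submodule.projectionOnto_apply_eq_zero_iff (G.isCompl (f x)).symm).2 (h.u w w.2)

theorem IsInvariantAt.blockB_eq_zero (h : IsInvariantAt f G x) : blockB f G x = 0 :=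
  LinearMap.ext fun w =>
    (Submodule.projectionOnto_apply_eq_zero_iff (G.isCompl (f x))).2 (h.s w w.2)

variable [FiniteDimensional ℝ E] [RiemannianBundle (fun x : M => TangentSpace 𝓘(ℝ, E) x)]

/-- The splitting into the graphs of `P` over `S.u` and of `Q` over `S.s`. -/
noncomputable def TangentSplitting.graphs (S : TangentSplitting E M) {η : ℝ} (hη : η < 1)
    (P : ∀ x, S.u x →L[ℝ] S.s x) (Q : ∀ x, S.s x →L[ℝ] S.u x) (hP : ∀ x, ‖P x‖ ≤ η)
    (hQ : ∀ x, ‖Q x‖ ≤ η) : TangentSplitting E M where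
  u x := graphOver (P x)
  s x := graphOver (Q x)
  isCompl x := isCompl_graphOver (S.isCompl x) (hP x) (hQ x) hη

/-- The invariant splitting `G` is almost as hyperbolic at `x` as `S`: the diagonal blocks lose
at most a factor `q`. -/
structure IsComparableAt (f : M → M) (S G : TangentSplitting E M) (q : ℝ) (x : M) : Prop where
  invariant : IsInvariantAt f G x
  minNorm_le : ENNReal.ofReal q * minNorm (blockA f S x) ≤ minNorm (blockA f G x)
  opNorm_le : opNorm (blockD f G x) ≤ q⁻¹ * opNorm (blockD f S x)

theorem isComparableAt_graphs {S : TangentSplitting E M} {η : ℝ} (hη : η < 1)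
    {P : ∀ x, S.u x →L[ℝ] S.s x} {Q : ∀ x, S.s x →L[ℝ] S.u x} (hP : ∀ x, ‖P x‖ ≤ η)
    (hQ : ∀ x, ‖Q x‖ ≤ η) {q ε : ℝ} (hq : 0 < q) (hqη : q * (1 + η) ^ 2 ≤ (1 - η) ^ 2)
    (hε : 0 ≤ ε) (hB : opNorm (blockB f S x) ≤ ε) (hC : opNorm (blockC f S x) ≤ ε)
    (hA : ∀ u, ε * ‖u‖ ≤ ‖blockA f S x u‖) (hD : ∀ s, ε * ‖s‖ ≤ ‖blockD f S x s‖)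
    (hPinv : ∀ u, P (f x) (blockA f S x u + blockB f S x (P x u)) =
      blockC f S x u + blockD f S x (P x u))
    (hQinv : ∀ s, blockA f S x (Q x s) + blockB f S x s =
      Q (f x) (blockC f S x (Q x s) + blockD f S x s)) :
    IsComparableAt f S (S.graphs hη P Q hP hQ) q x := by
  have hη0 : 0 ≤ η := (norm_nonneg (P x)).trans (hP x)
  have hBs (s : S.s x) : ‖blockB f S x s‖ ≤ ε * ‖s‖ :=
    (norm_le_opNorm_mul _ s).trans (mul_le_mul_of_nonneg_right hB (norm_nonneg s))
  have hCu (u : S.u x) : ‖blockC f S x u‖ ≤ ε * ‖u‖ :=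
    (norm_le_opNorm_mul _ u).trans (mul_le_mul_of_nonneg_right hC (norm_nonneg u))
  let T : TangentSpace 𝓘(ℝ, E) x →ₗ[ℝ] TangentSpace 𝓘(ℝ, E) (f x) :=
    (mfderiv 𝓘(ℝ, E) 𝓘(ℝ, E) f x).toLinearMap
  have hTu (u : S.u x) : T u =
      (blockA f S x u : TangentSpace 𝓘(ℝ, E) (f x)) + blockC f S x u := mfderiv_u u
  have hTs (s : S.s x) : T s =
      (blockB f S x s : TangentSpace 𝓘(ℝ, E) (f x)) + blockD f S x s := mfderiv_s s
  have hinv : IsInvariantAt f (S.graphs hη P Q hP hQ) x := by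
    refine ⟨fun w hw => ?_, fun w hw => ?_⟩
    · obtain ⟨u, rfl⟩ := mem_graphOver.1 hw
      exact mem_graphOver.2 ⟨_, (map_graph_eq hTu hTs hPinv u).symm⟩
    · obtain ⟨s, rfl⟩ := mem_graphOver.1 hw
      refine mem_graphOver.2 ⟨_, (map_graph_eq (fun s => (hTs s).trans (add_comm _ _))
        (fun u => (hTu u).trans (add_comm _ _)) (P' := Q (f x)) (fun s => ?_) s).symm⟩
      rw [add_comm (blockD f S x s), ← hQinv, add_comm]
  refine ⟨hinv, le_iInf₂ fun w hw => ?_, opNorm_le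
    (mul_nonneg (inv_nonneg.2 hq.le) (opNorm_nonneg _)) fun w => ?_⟩
  · obtain ⟨u, hu⟩ := mem_graphOver.1 w.2
    have hu0 : u ≠ 0 := by
      rintro rfl
      exact hw (Subtype.ext (by simpa using hu.symm))
    have key := mul_norm_le_norm_map_graph hTu hTs (hP x) (hP (f x)) hη.le hBs hA hε hPinv u
    rw [hu] at key
    have hw_norm := norm_add_apply_le (hP x) u
    rw [hu] at hw_norm
    have hblock : ‖blockA f (S.graphs hη P Q hP hQ) x w‖ = ‖T w‖ :=
      congrArg norm (hinv.coe_blockA w)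
    have hreal : q * ‖blockA f S x u‖ * ‖w‖ ≤ ‖T w‖ * ‖u‖ := by
      have h1 : q * (1 + η) ≤ (1 - η) ^ 2 := by
        refine le_trans ?_ hqη
        have : (1 + η) ≤ (1 + η) ^ 2 := by nlinarith
        exact mul_le_mul_of_nonneg_left this hq.le
      calc q * ‖blockA f S x u‖ * ‖w‖
          ≤ q * ‖blockA f S x u‖ * ((1 + η) * ‖u‖) :=
            mul_le_mul_of_nonneg_left hw_norm (by positivity)
        _ = (q * (1 + η)) * (‖blockA f S x u‖ * ‖u‖) := by ring
        _ ≤ (1 - η) ^ 2 * (‖blockA f S x u‖ * ‖u‖) :=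
            mul_le_mul_of_nonneg_right h1 (by positivity)
        _ = (1 - η) ^ 2 * ‖blockA f S x u‖ * ‖u‖ := by ring
        _ ≤ _ := mul_le_mul_of_nonneg_right key (norm_nonneg u)
    have hu_pos : 0 < ‖u‖ := norm_pos_iff.2 hu0
    have hw_pos : 0 < ‖w‖ := norm_pos_iff.2 hw
    calc ENNReal.ofReal q * minNorm (blockA f S x)
        ≤ ENNReal.ofReal q * (‖blockA f S x u‖ₑ / ‖u‖ₑ) :=
          mul_le_mul_right (iInf₂_le u hu0) _
      _ = ENNReal.ofReal (q * (‖blockA f S x u‖ / ‖u‖)) := by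
          rw [← ofReal_norm, ← ofReal_norm, ENNReal.ofReal_mul hq.le,
            ENNReal.ofReal_div_of_pos hu_pos]
      _ ≤ ENNReal.ofReal (‖T w‖ / ‖w‖) := by
          refine ENNReal.ofReal_le_ofReal ?_
          rw [← mul_div_assoc, div_le_div_iff₀ hu_pos hw_pos]
          exact hreal
      _ = _ := by
          rw [ENNReal.ofReal_div_of_pos hw_pos, ← hblock, ofReal_norm,
            ofReal_norm]
  · obtain ⟨s, hs⟩ := mem_graphOver.1 w.2
    have key := norm_map_graph_le hTu hTs (hQ x) (hQ (f x)) hCu hD hε hQinv s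
    rw [hs] at key
    have hw_norm := le_norm_add_apply (hQ x) s
    rw [hs] at hw_norm
    have hblock : ‖blockD f (S.graphs hη P Q hP hQ) x w‖ = ‖T w‖ :=
      congrArg norm (hinv.coe_blockD w)
    have h1 : q * (1 + η) ^ 2 ≤ 1 - η := by
      refine hqη.trans ?_
      nlinarith
    rw [hblock, mul_assoc, ← div_eq_inv_mul, le_div_iff₀ hq]
    have hd := opNorm_nonneg (blockD f S x)
    calc ‖T w‖ * q ≤ (1 + η) ^ 2 * (opNorm (blockD f S x) * ‖s‖) * q := by
          refine mul_le_mul_of_nonneg_right (key.trans ?_) hq.le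
          exact mul_le_mul_of_nonneg_left (norm_le_opNorm_mul _ s) (by positivity)
      _ = opNorm (blockD f S x) * ((q * (1 + η) ^ 2) * ‖s‖) := by ring
      _ ≤ opNorm (blockD f S x) * ((1 - η) * ‖s‖) :=
          mul_le_mul_of_nonneg_left (mul_le_mul_of_nonneg_right h1 (norm_nonneg s)) hd
      _ ≤ opNorm (blockD f S x) * ‖w‖ := mul_le_mul_of_nonneg_left hw_norm hd

/-- A loss of a factor `lam / lam'` at every step turns the rate `lam` into the rate `lam'`. -/
theorem IsQuasiSemiHyperbolicArc.of_isComparableAt {S : TangentSplitting E M} {lam lam' ε : ℝ}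
    (h_lam : 0 < lam) (h_lam' : 0 < lam') {n : ℕ} (h : IsQuasiSemiHyperbolicArc f S lam ε x n)
    (hG : ∀ j < n, IsComparableAt f S G (lam / lam') (f^[j] x)) :
    IsQuasiSemiHyperbolicArc f G lam' 0 x n where
  prod_D k hk hkn := by
    calc ∏ j ∈ Finset.range k, opNorm (blockD f G (f^[j] x))
        ≤ ∏ j ∈ Finset.range k, (lam / lam')⁻¹ * opNorm (blockD f S (f^[j] x)) :=
          Finset.prod_le_prod (fun j _ => opNorm_nonneg _) fun j hj =>
            (hG j ((Finset.mem_range.1 hj).trans_le hkn)).opNorm_le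
      _ = (lam / lam')⁻¹ ^ k * ∏ j ∈ Finset.range k, opNorm (blockD f S (f^[j] x)) := by
          rw [Finset.prod_mul_distrib, Finset.prod_const, Finset.card_range]
      _ ≤ (lam / lam')⁻¹ ^ k * lam ^ k :=
          mul_le_mul_of_nonneg_left (h.prod_D k hk hkn) (by positivity)
      _ = lam' ^ k := by rw [← mul_pow]; congr 1; field_simp
  prod_A k hk := by
    calc ENNReal.ofReal (lam' ^ ((k : ℤ) - (n : ℤ)))
        = ENNReal.ofReal (lam / lam') ^ (n - k) *
            ENNReal.ofReal (lam ^ ((k : ℤ) - (n : ℤ))) := by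
          rw [← ENNReal.ofReal_pow (by positivity), ← ENNReal.ofReal_mul (by positivity)]
          congr 1
          have e : (k : ℤ) - n = -((n - k : ℕ) : ℤ) := by omega
          rw [e, zpow_neg, zpow_neg, zpow_natCast, zpow_natCast, div_pow]
          field_simp
      _ ≤ ENNReal.ofReal (lam / lam') ^ (n - k) *
            ∏ j ∈ Finset.Ico k n, minNorm (blockA f S (f^[j] x)) :=
          mul_le_mul_right (h.prod_A k hk) _
      _ = ∏ j ∈ Finset.Ico k n,
            ENNReal.ofReal (lam / lam') * minNorm (blockA f S (f^[j] x)) := by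
          simp [Finset.prod_mul_distrib]
      _ ≤ _ := Finset.prod_le_prod' fun j hj => (hG j (Finset.mem_Ico.1 hj).2).minNorm_le
  ratio j hj := by
    have hq : 0 < lam / lam' := by positivity
    have hq0 : ENNReal.ofReal (lam / lam') ≠ 0 := by simpa using hq
    calc ENNReal.ofReal (opNorm (blockD f G (f^[j] x))) / minNorm (blockA f G (f^[j] x))
        ≤ ENNReal.ofReal ((lam / lam')⁻¹ * opNorm (blockD f S (f^[j] x))) /
            (ENNReal.ofReal (lam / lam') * minNorm (blockA f S (f^[j] x))) :=
          ENNReal.div_le_div (ENNReal.ofReal_le_ofReal (hG j hj).opNorm_le)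
            (hG j hj).minNorm_le
      _ = (ENNReal.ofReal (lam / lam'))⁻¹ ^ 2 * (ENNReal.ofReal (opNorm (blockD f S (f^[j] x))) /
            minNorm (blockA f S (f^[j] x))) := by
          rw [ENNReal.ofReal_mul (by positivity), ENNReal.ofReal_inv_of_pos hq,
            ENNReal.div_eq_inv_mul, ENNReal.div_eq_inv_mul, ENNReal.mul_inv (Or.inl hq0) (Or.inl ENNReal.ofReal_ne_top)]
          ring
      _ ≤ (ENNReal.ofReal (lam / lam'))⁻¹ ^ 2 * ENNReal.ofReal (lam ^ 2) :=
          mul_le_mul_right (h.ratio j hj) _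
      _ = ENNReal.ofReal (lam' ^ 2) := by
          rw [← ENNReal.ofReal_inv_of_pos hq, ← ENNReal.ofReal_pow (by positivity),
            ← ENNReal.ofReal_mul (by positivity), ← mul_pow]
          congr 2
          field_simp
  norm_B j hj := by
    rw [(hG j hj).invariant.blockB_eq_zero]
    exact opNorm_le le_rfl (by simp)
  norm_C j hj := by
    rw [(hG j hj).invariant.blockC_eq_zero]
    exact opNorm_le le_rfl (by simp)

end Blocks

end QuasiHyp

open QuasiHyp in
theorem theorem2p1 {E : Type*} [NormedAddCommGroup E] [NormedSpace ℝ E] [FiniteDimensional ℝ E]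
    {M : Type*} [EMetricSpace M] [CompactSpace M] [ChartedSpace E M] [IsManifold 𝓘(ℝ, E) ∞ M]
    [RiemannianBundle (fun x : M => TangentSpace 𝓘(ℝ, E) x)]
    [IsContMDiffRiemannianBundle 𝓘(ℝ, E) ∞ E (fun x : M => TangentSpace 𝓘(ℝ, E) x)]
    [IsRiemannianManifold 𝓘(ℝ, E) M]
    (f : M ≃ₘ^1⟮𝓘(ℝ, E), 𝓘(ℝ, E)⟯ M) (lam lam' : ℝ)
    (h_lam : 0 < lam) (h_lt : lam < lam') (h_lam' : lam' < 1)
    (S : QuasiHyp.TangentSplitting E M) (hS : S.IsContinuous) :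
    ∃ ε₀ δ₀ : ℝ, 0 < ε₀ ∧ 0 < δ₀ ∧
      ∀ ε δ : ℝ, 0 < ε → ε ≤ ε₀ → 0 < δ → δ ≤ δ₀ →
        ∀ (x : ℤ → M) (n : ℤ → ℕ),
          QuasiHyp.IsQuasiSemiHyperbolicPseudoOrbit f S lam ε δ x n →
            ∃ G : QuasiHyp.TangentSplitting E M,
              QuasiHyp.IsQuasiHyperbolicPseudoOrbit f G lam' δ x n := by
  have := QuasiHyp.isContinuousRiemannianBundle (E := E) (M := M)
  obtain ⟨c, hc, hcf⟩ := QuasiHyp.exists_le_norm_mfderiv f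
  have h_lam'0 : 0 < lam' := h_lam.trans h_lt
  have hq1 : lam / lam' < 1 := (div_lt_one h_lam'0).2 h_lt
  obtain ⟨η, hη0, hη1, hqη⟩ := QuasiHyp.exists_slope_bound hq1
  have hσ1 : lam ^ 2 < 1 := pow_lt_one₀ h_lam.le (h_lt.trans h_lam') two_ne_zero
  have hadm := QuasiHyp.isAdmissible (sq_nonneg lam) hσ1 hη0.le hη1.le
  set τ : ℝ := η * (1 - lam ^ 2) / 4 with hτ
  have hτ0 : 0 < τ := div_pos (mul_pos hη0 (sub_pos.2 hσ1)) (by norm_num)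
  have hτ1 : τ ≤ 1 := by
    have := mul_le_one₀ hη1.le (sub_nonneg.2 hσ1.le) (sub_le_self 1 (sq_nonneg lam))
    rw [hτ]
    linarith
  -- The jumps carry over verbatim, so any `δ₀` works.
  refine ⟨τ * (c / 2), 1, by positivity, one_pos, fun ε δ hε hε₀ _ _ x n hx => ?_⟩
  have hεc : ε ≤ c - ε := by
    have := mul_le_mul_of_nonneg_right hτ1 (by linarith : 0 ≤ c / 2)
    linarith
  -- The points at which the pseudo-orbit makes a step; the final points of the segments are in `Λ`
  -- only if they also occur as such a point.
  let Λ : Set M := {y | ∃ i, ∃ j < n i, f^[j] (x i) = y}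
  have hΛ (y : M) (hy : y ∈ Λ) : opNorm (blockB f S y) ≤ ε ∧ opNorm (blockC f S y) ≤ ε ∧
      ENNReal.ofReal (opNorm (blockD f S y)) / minNorm (blockA f S y) ≤
        ENNReal.ofReal (lam ^ 2) := by
    obtain ⟨i, j, hj, rfl⟩ := hy
    exact ⟨(hx.arc i).norm_B j hj, (hx.arc i).norm_C j hj, (hx.arc i).ratio j hj⟩
  have hdom (y : M) (hy : y ∈ Λ) : IsDominated (blockA f S y) (blockB f S y) (blockC f S y)
      (blockD f S y) (lam ^ 2) τ := by
    obtain ⟨hB, hC, hr⟩ := hΛ y hy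
    exact isDominated_of_ratio (T := (mfderiv 𝓘(ℝ, E) 𝓘(ℝ, E) f y).toLinearMap) (S.isCompl y)
      (S.isCompl (f y)) rfl hc (by positivity) hτ0.le hτ1 hε₀ (hcf y) mfderiv_u mfderiv_s
      hB hC hr
  obtain ⟨P, hP, hPinv⟩ := exists_invariant_graph_forward f.bijective Λ hdom hadm
  obtain ⟨Q, hQ, hQinv⟩ := exists_invariant_graph_backward Λ hdom hadm
  refine ⟨S.graphs hη1 P Q hP hQ, hx.length_pos, fun i => ?_, hx.jump⟩
  refine (hx.arc i).of_isComparableAt h_lam h_lam'0 fun j hj => ?_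
  have hy : f^[j] (x i) ∈ Λ := ⟨i, j, hj, rfl⟩
  obtain ⟨hB, hC, -⟩ := hΛ _ hy
  refine isComparableAt_graphs hη1 hP hQ (by positivity) hqη hε.le hB hC (fun u => ?_)
    (fun s => ?_) (hPinv _ hy) (hQinv _ hy)
  · refine (mul_le_mul_of_nonneg_right hεc (norm_nonneg u)).trans ?_
    exact le_norm_of_le_norm_map (T := (mfderiv 𝓘(ℝ, E) 𝓘(ℝ, E) f (f^[j] (x i))).toLinearMap)
      (hcf _) mfderiv_u (fun u => (norm_le_opNorm_mul _ u).trans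
        (mul_le_mul_of_nonneg_right hC (norm_nonneg u))) u
  · refine (mul_le_mul_of_nonneg_right hεc (norm_nonneg s)).trans ?_
    exact le_norm_of_le_norm_map (T := (mfderiv 𝓘(ℝ, E) 𝓘(ℝ, E) f (f^[j] (x i))).toLinearMap)
      (hcf _) (fun s => (mfderiv_s s).trans (add_comm _ _)) (fun s => (norm_le_opNorm_mul _ s).trans
        (mul_le_mul_of_nonneg_right hB (norm_nonneg s))) s
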